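/- A contracting similarity of $\mathbb{R}^d$ is a map $S:\mathbb{R}^d\to\mathbb{R}^d$ such that for some $0<r<1$ we have $|S(x)-S(y)|=r|x-y|$ for all $x,y$; it can be written uniquely as $S(x)=rT(x)+v$ with $T$ an orthogonal transformation (the orthogonal part of $S$) and $v\in\mathbb{R}^d$. A self-similar IFS (SS-IFS) is a finite family $\{S_i\}_{i=1}^m$ of contracting similarities of $\mathbb{R}^d$. Its attractor is the unique nonempty compact set $K$ with $K=\bigcup_{i=1}^m S_i(K)$; it satisfies the strong separation condition (SSC) if the sets $S_1(K),\ldots,S_m(K)$ are pairwise disjoint; its transformation group $\mathcal{T}$ is the group generated by the orthogonal parts $T_1,\ldots,T_m$ of $S_1,\ldots,S_m$. Proposition. Let $\{S_i\}_{i=1}^m$ be an SS-IFS in $\mathbb{R}^d$ whose attractor $K$ contains at least two points, and let $\mathcal{T}$ be its transformation group. For every $\varepsilon>0$ there exists an SS-IFS $\{\widehat S_i\}_{i=1}^{\widehat m}$ in $\mathbb{R}^d$ that satisfies the SSC, with attractor $\widehat K$ containing at least two points, such that $\widehat K\subseteq K$, $\dim_H K-\varepsilon<\dim_H\widehat K$,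 and the transformation group $\widehat{\mathcal{T}}$ of $\{\widehat S_i\}_{i=1}^{\widehat m}$ is dense in $\mathcal{T}$, that is, $\widehat{\mathcal{T}}\subseteq\mathcal{T}$ and $\mathcal{T}$ is contained in the closure of $\widehat{\mathcal{T}}$ in the orthogonal group. -/

import Mathlib

namespace SelfSimilar

/-- The Euclidean space `ℝ^d`. -/
abbrev Eucl (d : ℕ) : Type := EuclideanSpace ℝ (Fin d)

/-- The orthogonal group of `ℝ^d` (linear operators with `T* T = T T* = 1`), with
the topology of the operator norm. -/
abbrev OrthGroup (d : ℕ) : Type := unitary (Eucl d →L[ℝ] Eucl d)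

/-- `S` is a contracting similarity: it multiplies all distances by some `r ∈ (0, 1)`. -/
def IsContractingSimilarity {d : ℕ} (S : Eucl d → Eucl d) : Prop :=
  ∃ r : ℝ, 0 < r ∧ r < 1 ∧ ∀ x y, dist (S x) (S y) = r * dist x y

/-- A self-similar iterated function system: a finite family of contracting similarities. -/
def IsSSIFS {d m : ℕ} (S : Fin m → Eucl d → Eucl d) : Prop :=
  ∀ i, IsContractingSimilarity (S i)

/-- `K` is the attractor of the system: a nonempty compact set with `K = ⋃ i, S i (K)`. -/
structure IsAttractor {d m : ℕ} (S : Fin m → Eucl d → Eucl d) (K : Set (Eucl d)) : Prop where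
  nonempty : K.Nonempty
  isCompact : IsCompact K
  eq_iUnion : K = ⋃ i, S i '' K

/-- The strong separation condition for a system with attractor `K`: the union `⋃ i, S i (K)`
is disjoint. -/
def StrongSeparation {d m : ℕ} (S : Fin m → Eucl d → Eucl d) (K : Set (Eucl d)) : Prop :=
  ∀ i j, i ≠ j → Disjoint (S i '' K) (S j '' K)

/-- `T` is the orthogonal part of `S`: `S x = r T x + v` with `0 < r < 1`. -/
def IsOrthogonalPart {d : ℕ} (T : OrthGroup d) (S : Eucl d → Eucl d) : Prop :=
  ∃ (r : ℝ) (v : Eucl d), 0 < r ∧ r < 1 ∧ ∀ x, S x = r • (T : Eucl d →L[ℝ] Eucl d) x + v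

/-- The transformation group of the system: the group generated by the orthogonal parts of
its maps. -/
noncomputable def transformationGroup {d m : ℕ} (S : Fin m → Eucl d → Eucl d) : Subgroup (OrthGroup d) :=
  Subgroup.closure {T | ∃ i, IsOrthogonalPart T (S i)}

end SelfSimilar

namespace SelfSimilar

open Set Metric
open scoped NNReal ENNReal

/-! The new system consists of compositions of the `S i` along finite words with pairwise disjoint
cylinders. Its invariant set lies in `K` and inherits separation. The words must keep the
transformation group and nearly keep the dimension.

Dimension: for `t < dimH K`, a Vitali selection among cylinders of equal word length gives disjoint
families whose sums of `t`-th powers of ratios are unbounded (`exists_disjoint_words_le_sum_rpow`).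
Conversely, a separated system with such a sum at least 1 has dimension at least `t`
(`le_dimH_of_one_le_sum_rpow`): coupling it with affine maps that tile `[0, 1]` gives a `t`-Hölder
map from part of the invariant set onto a set containing `[0, 1]`.

Group: since `K` has two points, some cylinders `p` and `q` are disjoint. The words `p ^ (k + 1) q
u`, with `u` empty twice and then each letter, are separated from each other and from all words `q
v`. Their orthogonal parts generate the whole group, so equality holds, which is stronger than
density. The prefix `q` costs a fixed factor, absorbed by the unbounded sums. -/

/-! ### Invariant sets and a lower bound for the dimension -/

/-- Finitely many contractions of a compact set into itself have a nonempty compact invariant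
set inside it. -/
theorem exists_isCompact_eq_iUnion_image {X ι : Type*} [MetricSpace X] [Finite ι] [Nonempty ι]
    {f : ι → X → X} {c : ι → ℝ≥0} (hc : ∀ i, c i < 1) (hf : ∀ i, LipschitzWith (c i) (f i))
    {C : Set X} (hC : IsCompact C) (hne : C.Nonempty) (hmaps : ∀ i, MapsTo (f i) C C) :
    ∃ G ⊆ C, G.Nonempty ∧ IsCompact G ∧ G = ⋃ i, f i '' G := by
  let F : Set X → Set X := fun A => ⋃ i, f i '' A
  have Fmono : Monotone F := fun A B h => iUnion_mono fun i => image_mono h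
  -- The greatest `A ⊆ C` with `A ⊆ F A`, as in Knaster–Tarski. Its closure has the same property,
  -- so it is closed; it contains the fixed points in `C`, so it is nonempty.
  let G : Set X := ⋃₀ {A | A ⊆ C ∧ A ⊆ F A}
  have hGC : G ⊆ C := sUnion_subset fun A hA => hA.1
  have hmax : ∀ A, A ⊆ C → A ⊆ F A → A ⊆ G := fun A h1 h2 => subset_sUnion_of_mem ⟨h1, h2⟩
  have hGF : G ⊆ F G := sUnion_subset fun A hA =>
    hA.2.trans (Fmono (hmax A hA.1 hA.2))
  have hFG : F G ⊆ G := hmax _ (iUnion_subset fun i => by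
    rintro _ ⟨x, hx, rfl⟩
    exact hmaps i (hGC hx)) (Fmono hGF)
  have hclC : closure G ⊆ C := closure_minimal hGC hC.isClosed
  have hcl : IsCompact (closure G) := hC.of_isClosed_subset isClosed_closure hclC
  have hclG : closure G ⊆ G := by
    apply hmax _ hclC
    have : IsCompact (F (closure G)) := isCompact_iUnion fun i => hcl.image (hf i).continuous
    exact closure_minimal (hGF.trans (Fmono subset_closure)) this.isClosed
  refine ⟨G, hGC, ?_, ?_, hGF.antisymm hFG⟩
  · obtain ⟨i⟩ := ‹Nonempty ι›
    obtain ⟨x, hx⟩ := hne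
    have hcon : ContractingWith (c i) ((hmaps i).restrict (f i) C C) :=
      ⟨hc i, fun x y => hf i x y⟩
    obtain ⟨y, hy, hfix, -⟩ := hcon.exists_fixedPoint' hC.isComplete (hmaps i) hx
      (edist_ne_top _ _)
    refine ⟨y, hmax {y} (singleton_subset_iff.2 hy) ?_ rfl⟩
    exact singleton_subset_iff.2 (mem_iUnion.2 ⟨i, y, rfl, hfix⟩)
  · rwa [hclG.antisymm subset_closure] at hcl

/-- Consecutive intervals of prescribed lengths tile an interval. -/
theorem exists_interval_tiling {ι : Type*} (s : Finset ι) (hs : s.Nonempty)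
    (p : ι → ℝ) (hp : ∀ i, 0 ≤ p i) :
    ∃ b : ι → ℝ, (∀ i ∈ s, 0 ≤ b i ∧ b i + p i ≤ ∑ j ∈ s, p j) ∧
      ∀ x, 0 ≤ x → x ≤ ∑ j ∈ s, p j → ∃ i ∈ s, b i ≤ x ∧ x ≤ b i + p i := by
  classical
  induction hs using Finset.Nonempty.cons_induction with
  | singleton a => exact ⟨fun _ => 0, by simp, fun x h0 h1 => ⟨a, by simp, h0, by simpa using h1⟩⟩
  | cons a s ha hs ih =>
    obtain ⟨b, hb, hx⟩ := ih
    rw [Finset.sum_cons]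
    refine ⟨Function.update b a (∑ j ∈ s, p j), fun i hi => ?_, fun x h0 h1 => ?_⟩
    · by_cases h : i = a
      · subst h
        simp only [Function.update_self]
        exact ⟨Finset.sum_nonneg fun j _ => hp j, by linarith⟩
      · have his : i ∈ s := (Finset.mem_cons.1 hi).resolve_left h
        rw [Function.update_of_ne h]
        exact ⟨(hb i his).1, by linarith [(hb i his).2, hp a]⟩
    · rcases le_total x (∑ j ∈ s, p j) with h | h
      · obtain ⟨i, hi, h2⟩ := hx x h0 h
        refine ⟨i, Finset.mem_cons_of_mem hi, ?_⟩
        rwa [Function.update_of_ne (ne_of_mem_of_not_mem hi ha)]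
      · refine ⟨a, Finset.mem_cons_self _ _, ?_⟩
        simp only [Function.update_self]
        exact ⟨h, by linarith⟩

/-- If the images of `[0, 1]` under finitely many affine contractions cover `[0, 1]`, then every
nonempty compact set that is mapped into itself contains `[0, 1]`. -/
theorem Icc_subset_of_affine_invariant {ι : Type*} {p b : ι → ℝ}
    (hp0 : ∀ i, 0 ≤ p i) (hp1 : ∀ i, p i < 1)
    (hcov : ∀ x ∈ Icc (0 : ℝ) 1, ∃ i, b i ≤ x ∧ x ≤ b i + p i) (hpos : ∀ i, 0 < p i)
    {A : Set ℝ} (hA : IsCompact A) (hne : A.Nonempty)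
    (hinv : ∀ i, ∀ a ∈ A, p i * a + b i ∈ A) : Icc (0 : ℝ) 1 ⊆ A := by
  -- At a point of `[0, 1]` farthest from `A`, pulling back by a covering map and pushing forward
  -- again shrinks the distance by `p i < 1`, so the maximum is 0.
  obtain ⟨x, hx, hmax⟩ := isCompact_Icc.exists_isMaxOn (nonempty_Icc.2 zero_le_one)
    (continuous_infDist_pt A).continuousOn
  obtain ⟨i, h1, h2⟩ := hcov x hx
  have hy : (x - b i) / p i ∈ Icc (0 : ℝ) 1 :=
    ⟨div_nonneg (by linarith) (hp0 i), (div_le_one (hpos i)).2 (by linarith)⟩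
  obtain ⟨a, ha, hay⟩ := hA.exists_infDist_eq_dist hne ((x - b i) / p i)
  have hle : infDist x A ≤ p i * infDist ((x - b i) / p i) A := by
    rw [hay]
    refine (infDist_le_dist_of_mem (hinv i a ha)).trans_eq ?_
    rw [Real.dist_eq, Real.dist_eq, ← abs_of_nonneg (hp0 i), ← abs_mul, abs_of_nonneg (hp0 i)]
    congr 1
    field_simp [(hpos i).ne']
    ring
  have hle' : infDist ((x - b i) / p i) A ≤ infDist x A := hmax hy
  have hzero : infDist x A = 0 := by
    have := infDist_nonneg (x := x) (s := A)
    nlinarith [hp0 i, hp1 i]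
  intro z hz
  rw [hA.isClosed.mem_iff_infDist_zero hne]
  exact le_antisymm ((hmax hz).trans_eq hzero) infDist_nonneg

/-- Compact sets indexed by a finite type that are pairwise disjoint are uniformly separated. -/
theorem exists_uniform_gap {X ι : Type*} [MetricSpace X] [Finite ι] {A : ι → Set X}
    (hA : ∀ i, IsCompact (A i)) (hdisj : ∀ i j, i ≠ j → Disjoint (A i) (A j)) :
    ∃ δ : ℝ, 0 < δ ∧ ∀ i j, i ≠ j → ∀ x ∈ A i, ∀ y ∈ A j, δ ≤ dist x y := by
  classical
  have h : ∀ z : ι × ι, ∃ δ : ℝ, 0 < δ ∧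
      (z.1 ≠ z.2 → ∀ x ∈ A z.1, ∀ y ∈ A z.2, δ ≤ dist x y) := by
    rintro ⟨i, j⟩
    by_cases hij : i = j
    · exact ⟨1, one_pos, fun h => (h hij).elim⟩
    · obtain ⟨r, hr, h⟩ := exists_pos_forall_lt_edist (hA i) (hA j).isClosed (hdisj i j hij)
      refine ⟨r, hr, fun _ x hx y hy => ?_⟩
      have := h x hx y hy
      rw [edist_nndist, ENNReal.coe_lt_coe] at this
      exact_mod_cast this.le
  choose δ hδ h using h
  cases isEmpty_or_nonempty ι
  · exact ⟨1, one_pos, fun i => isEmptyElim i⟩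
  obtain ⟨z, hz⟩ := Finite.exists_min δ
  exact ⟨δ z, hδ z, fun i j hij x hx y hy => (hz (i, j)).trans (h (i, j) hij x hx y hy)⟩

/-- If similarities with ratios `r i` map a nonempty compact set `K` to pairwise disjoint subsets
of `K` and `1 ≤ ∑ i, r i ^ t`, then `K` has Hausdorff dimension at least `t`. -/
theorem le_dimH_of_one_le_sum_rpow {X ι : Type*} [MetricSpace X] [Fintype ι]
    {f : ι → X → X} {r : ι → ℝ} (hr0 : ∀ i, 0 < r i) (hr1 : ∀ i, r i < 1)
    (hf : ∀ i x y, dist (f i x) (f i y) = r i * dist x y)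
    {K : Set X} (hK : IsCompact K) (hne : K.Nonempty) (hmaps : ∀ i, MapsTo (f i) K K)
    (hdisj : ∀ i j, i ≠ j → Disjoint (f i '' K) (f j '' K))
    {t : ℝ≥0} (ht : 0 < t) (hsum : 1 ≤ ∑ i, r i ^ (t : ℝ)) : (t : ℝ≥0∞) ≤ dimH K := by
  have hι : Nonempty ι := by
    by_contra h
    rw [not_nonempty_iff] at h
    simp at hsum
    linarith
  set σ := ∑ i, r i ^ (t : ℝ) with hσ
  have hσ0 : 0 < σ := by linarith
  have hrt : ∀ i, 0 < r i ^ (t : ℝ) := fun i => Real.rpow_pos_of_pos (hr0 i) _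
  -- Normalised weights: their sum 1 lets the intervals tile `[0, 1]`, while `1 ≤ σ` keeps `p i ≤ r
  -- i ^ t`, as the Hölder estimate requires.
  set p : ι → ℝ := fun i => r i ^ (t : ℝ) / σ with hp
  have hp0 : ∀ i, 0 < p i := fun i => div_pos (hrt i) hσ0
  have hple : ∀ i, p i ≤ r i ^ (t : ℝ) := fun i => div_le_self (hrt i).le hsum
  have hp1 : ∀ i, p i < 1 := fun i =>
    (hple i).trans_lt (Real.rpow_lt_one (hr0 i).le (hr1 i) (by exact_mod_cast ht))
  have hpsum : ∑ i, p i = 1 := by rw [hp, ← Finset.sum_div, ← hσ, div_self hσ0.ne']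
  obtain ⟨b, hb, hcov⟩ := exists_interval_tiling Finset.univ Finset.univ_nonempty p
    fun i => (hp0 i).le
  rw [hpsum] at hb hcov
  have hfL : ∀ i, LipschitzWith (r i).toNNReal (f i) := fun i =>
    LipschitzWith.of_dist_le' fun x y => (hf i x y).le
  let g : ι → ℝ → ℝ := fun i a => p i * a + b i
  have hg : ∀ i a a', |g i a - g i a'| = p i * |a - a'| := fun i a a' => by
    have : g i a - g i a' = p i * (a - a') := by
      simp only [g]
      ring
    rw [this, abs_mul, abs_of_pos (hp0 i)]
  have hgL : ∀ i, LipschitzWith (p i).toNNReal (g i) := fun i =>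
    LipschitzWith.of_dist_le' fun x y => (hg i x y).le
  obtain ⟨G, hGC, hGne, hGc, hG⟩ := exists_isCompact_eq_iUnion_image
    (f := fun i (z : X × ℝ) => (f i z.1, g i z.2))
    (c := fun i => max ((r i).toNNReal * 1) ((p i).toNNReal * 1))
    (fun i => by
      rw [mul_one, mul_one]
      exact max_lt (Real.toNNReal_lt_one.2 (hr1 i)) (Real.toNNReal_lt_one.2 (hp1 i)))
    (fun i => ((hfL i).comp LipschitzWith.prod_fst).prodMk ((hgL i).comp LipschitzWith.prod_snd))
    (hK.prod (isCompact_Icc (a := (0 : ℝ)) (b := 1))) (hne.prod (nonempty_Icc.2 zero_le_one))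
    (fun i z hz => ⟨hmaps i hz.1, by
      have h1 := hz.2.1
      have h2 := hz.2.2
      have h3 := (hb i (Finset.mem_univ i)).1
      have h4 := (hb i (Finset.mem_univ i)).2
      have h5 := hp0 i
      constructor
      · show 0 ≤ p i * z.2 + b i
        positivity
      · show p i * z.2 + b i ≤ 1
        nlinarith⟩)
  obtain ⟨δ, hδ, hgap⟩ := exists_uniform_gap (fun i => hK.image (hfL i).continuous) hdisj
  have hC0 : 0 < δ⁻¹ ^ (t : ℝ) := Real.rpow_pos_of_pos (inv_pos.2 hδ) _
  set C : ℝ := δ⁻¹ ^ (t : ℝ) with hC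
  obtain ⟨i₀, hi₀⟩ := Finite.exists_max p
  have hunit : ∀ z ∈ G, ∀ w ∈ G, |z.2 - w.2| ≤ 1 := fun z hz w hw => by
    have h1 := (hGC hz).2
    have h2 := (hGC hw).2
    rw [abs_le]
    constructor <;> linarith [h1.1, h1.2, h2.1, h2.2]
  -- If both points come from the same map, the estimate rescales by `p i ≤ r i ^ t`. Otherwise the
  -- first coordinates are at least `δ` apart, and `C = δ⁻¹ ^ t` makes the right side at least 1.
  -- The error term vanishes as `n` grows.
  have key : ∀ n : ℕ, ∀ z ∈ G, ∀ w ∈ G,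
      |z.2 - w.2| ≤ C * dist z.1 w.1 ^ (t : ℝ) + p i₀ ^ n := by
    intro n
    induction n with
    | zero =>
      intro z hz w hw
      have : 0 ≤ C * dist z.1 w.1 ^ (t : ℝ) := by positivity
      rw [pow_zero]
      linarith [hunit z hz w hw]
    | succ n ih =>
      intro z hz w hw
      have hz' := hz
      have hw' := hw
      rw [hG] at hz' hw'
      obtain ⟨i, z', hz', hzz⟩ := mem_iUnion.1 hz'
      obtain ⟨j, w', hw', hww⟩ := mem_iUnion.1 hw'
      have hpn : 0 ≤ p i₀ ^ (n + 1) := pow_nonneg (hp0 i₀).le _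
      by_cases hij : i = j
      · subst hij
        rw [← hzz, ← hww]
        dsimp only
        rw [hg, hf, Real.mul_rpow (hr0 i).le dist_nonneg]
        have h1 := ih z' hz' w' hw'
        have h2 : 0 ≤ C * dist z'.1 w'.1 ^ (t : ℝ) := by positivity
        calc p i * |z'.2 - w'.2| ≤ p i * (C * dist z'.1 w'.1 ^ (t : ℝ) + p i₀ ^ n) := by
              gcongr
              exact (hp0 i).le
          _ = p i * (C * dist z'.1 w'.1 ^ (t : ℝ)) + p i * p i₀ ^ n := by ring
          _ ≤ r i ^ (t : ℝ) * (C * dist z'.1 w'.1 ^ (t : ℝ)) + p i₀ * p i₀ ^ n := by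
              gcongr
              · exact hple i
              · exact pow_nonneg (hp0 i₀).le _
              · exact hi₀ i
          _ = _ := by ring
      · have hd : δ ≤ dist z.1 w.1 := by
          rw [← hzz, ← hww]
          exact hgap i j hij _ ⟨_, (hGC hz').1, rfl⟩ _ ⟨_, (hGC hw').1, rfl⟩
        have : 1 ≤ C * dist z.1 w.1 ^ (t : ℝ) := by
          rw [hC, ← Real.mul_rpow (inv_pos.2 hδ).le dist_nonneg]
          apply Real.one_le_rpow _ t.coe_nonneg
          rw [inv_mul_eq_div]
          exact (one_le_div hδ).2 hd
        linarith [hunit z hz w hw]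
  have holder : ∀ z ∈ G, ∀ w ∈ G, |z.2 - w.2| ≤ C * dist z.1 w.1 ^ (t : ℝ) := by
    intro z hz w hw
    have h1 := tendsto_pow_atTop_nhds_zero_of_lt_one (hp0 i₀).le (hp1 i₀)
    have h2 := h1.const_add (C * dist z.1 w.1 ^ (t : ℝ))
    rw [add_zero] at h2
    exact ge_of_tendsto' h2 fun n => key n z hz w hw
  have hsec : ∀ x, ∃ a, x ∈ Prod.fst '' G → (x, a) ∈ G := by
    intro x
    by_cases hx : x ∈ Prod.fst '' G
    · obtain ⟨z, hz, rfl⟩ := hx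
      exact ⟨z.2, fun _ => hz⟩
    · exact ⟨0, fun h => (hx h).elim⟩
  choose h hh using hsec
  have hHolder : HolderOnWith C.toNNReal t h (Prod.fst '' G) := by
    intro x hx y hy
    have h1 := holder _ (hh x hx) _ (hh y hy)
    rw [edist_dist, edist_dist, Real.dist_eq, ENNReal.ofReal_rpow_of_nonneg dist_nonneg t.coe_nonneg]
    change _ ≤ ENNReal.ofReal C * _
    rw [← ENNReal.ofReal_mul hC0.le]
    exact ENNReal.ofReal_le_ofReal h1
  -- Points of `G` with equal first coordinate have equal second coordinate by the Hölder bound, so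
  -- `G` is the graph of `h`.
  have himg : Prod.snd '' G ⊆ h '' (Prod.fst '' G) := by
    rintro _ ⟨z, hz, rfl⟩
    refine ⟨z.1, ⟨z, hz, rfl⟩, ?_⟩
    have h1 := holder _ (hh z.1 ⟨z, hz, rfl⟩) _ hz
    rw [dist_self, Real.zero_rpow (by exact_mod_cast ht.ne'), mul_zero] at h1
    exact sub_eq_zero.1 (abs_nonpos_iff.1 h1)
  have hIcc : Icc (0 : ℝ) 1 ⊆ Prod.snd '' G := by
    apply Icc_subset_of_affine_invariant (fun i => (hp0 i).le) hp1 _ hp0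
      (hGc.image continuous_snd) (hGne.image _) _ (b := b)
    · intro x hx
      obtain ⟨i, -, h⟩ := hcov x hx.1 hx.2
      exact ⟨i, h⟩
    · rintro i _ ⟨z, hz, rfl⟩
      refine ⟨(f i z.1, g i z.2), ?_, rfl⟩
      rw [hG]
      exact mem_iUnion.2 ⟨i, z, hz, rfl⟩
  have hdim1 : (1 : ℝ≥0∞) ≤ dimH (h '' (Prod.fst '' G)) := by
    have : dimH (Icc (0 : ℝ) 1) = Module.finrank ℝ ℝ :=
      Real.dimH_of_nonempty_interior (by simp)
    rw [Module.finrank_self, Nat.cast_one] at this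
    rw [← this]
    exact dimH_mono (hIcc.trans himg)
  have hfst : Prod.fst '' G ⊆ K := by
    rintro _ ⟨z, hz, rfl⟩
    exact (hGC hz).1
  have ht0 : (t : ℝ≥0∞) ≠ 0 := by exact_mod_cast ht.ne'
  have := hdim1.trans ((hHolder.dimH_image_le ht).trans
    (ENNReal.div_le_div_right (dimH_mono hfst) _))
  rwa [ENNReal.le_div_iff_mul_le (Or.inl ht0) (Or.inl ENNReal.coe_ne_top), one_mul] at this

/-! ### Words and cylinders -/

/-- The composition of the maps of a system along a finite word. -/
def wordMap {X ι : Type*} (S : ι → X → X) : List ι → X → X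
  | [] => id
  | i :: w => S i ∘ wordMap S w

/-- The product of the ratios along a finite word. -/
def wordRatio {ι : Type*} (r : ι → ℝ) (w : List ι) : ℝ := (w.map r).prod

theorem wordMap_append {X ι : Type*} (S : ι → X → X) (u w : List ι) :
    wordMap S (u ++ w) = wordMap S u ∘ wordMap S w := by
  induction u with
  | nil => rfl
  | cons i u ih => simp only [List.cons_append, wordMap, ih, Function.comp_assoc]

theorem wordRatio_cons {ι : Type*} (r : ι → ℝ) (i : ι) (w : List ι) :
    wordRatio r (i :: w) = r i * wordRatio r w := by
  simp [wordRatio]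

theorem wordRatio_append {ι : Type*} (r : ι → ℝ) (u w : List ι) :
    wordRatio r (u ++ w) = wordRatio r u * wordRatio r w := by
  simp [wordRatio]

theorem wordRatio_pos {ι : Type*} {r : ι → ℝ} (hr : ∀ i, 0 < r i) (w : List ι) :
    0 < wordRatio r w := by
  induction w with
  | nil => simp [wordRatio]
  | cons i w ih =>
    rw [wordRatio_cons]
    exact mul_pos (hr i) ih

theorem wordRatio_le_pow {ι : Type*} {r : ι → ℝ} {ρ : ℝ} (hr : ∀ i, 0 < r i)
    (hρ : ∀ i, r i ≤ ρ) (w : List ι) : wordRatio r w ≤ ρ ^ w.length := by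
  induction w with
  | nil => simp [wordRatio]
  | cons i w ih =>
    rw [wordRatio_cons, List.length_cons, pow_succ']
    exact mul_le_mul (hρ i) ih (wordRatio_pos hr w).le ((hr i).le.trans (hρ i))

theorem wordRatio_lt_one {ι : Type*} {r : ι → ℝ} (hr0 : ∀ i, 0 < r i) (hr1 : ∀ i, r i < 1)
    {w : List ι} (hw : w ≠ []) : wordRatio r w < 1 := by
  cases w with
  | nil => exact (hw rfl).elim
  | cons i w =>
    rw [wordRatio_cons]
    have h := wordRatio_le_pow hr0 (fun i => (hr1 i).le) w
    rw [one_pow] at h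
    have := hr1 i
    have := hr0 i
    nlinarith

theorem exists_uniform_ratio {ι : Type*} [Finite ι] {r : ι → ℝ} (hr1 : ∀ i, r i < 1) :
    ∃ ρ : ℝ, 0 ≤ ρ ∧ ρ < 1 ∧ ∀ i, r i ≤ ρ := by
  cases isEmpty_or_nonempty ι
  · exact ⟨0, le_rfl, one_pos, fun i => isEmptyElim i⟩
  obtain ⟨i, hi⟩ := Finite.exists_max r
  exact ⟨max (r i) 0, le_max_right _ _, max_lt (hr1 i) one_pos,
    fun j => (hi j).trans (le_max_left _ _)⟩

theorem dist_wordMap {X ι : Type*} [MetricSpace X] {S : ι → X → X} {r : ι → ℝ}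
    (hS : ∀ i x y, dist (S i x) (S i y) = r i * dist x y) (w : List ι) (x y : X) :
    dist (wordMap S w x) (wordMap S w y) = wordRatio r w * dist x y := by
  induction w with
  | nil => simp [wordMap, wordRatio]
  | cons i w ih => rw [wordRatio_cons, mul_assoc, ← ih, ← hS]; rfl

theorem wordMap_injective {X ι : Type*} [MetricSpace X] {S : ι → X → X} {r : ι → ℝ}
    (hS : ∀ i x y, dist (S i x) (S i y) = r i * dist x y) (hr : ∀ i, 0 < r i) (w : List ι) :
    Function.Injective (wordMap S w) := by
  intro x y hxy
  have h := dist_wordMap hS w x y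
  rw [hxy, dist_self] at h
  exact dist_eq_zero.1 ((mul_eq_zero.1 h.symm).resolve_left (wordRatio_pos hr w).ne')

theorem mapsTo_wordMap {X ι : Type*} {S : ι → X → X} {K : Set X} (hK : K = ⋃ i, S i '' K)
    (w : List ι) : MapsTo (wordMap S w) K K := by
  induction w with
  | nil => exact mapsTo_id K
  | cons i w ih =>
    intro x hx
    rw [hK]
    exact mem_iUnion.2 ⟨i, _, ih hx, rfl⟩

theorem image_wordMap_append_subset {X ι : Type*} {S : ι → X → X} {K : Set X}
    (hK : K = ⋃ i, S i '' K) (u w : List ι) :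
    wordMap S (u ++ w) '' K ⊆ wordMap S u '' K := by
  rw [wordMap_append, image_comp]
  exact image_mono (mapsTo_wordMap hK w).image_subset

theorem exists_mem_image_wordMap {X ι : Type*} {S : ι → X → X} {K : Set X}
    (hK : K = ⋃ i, S i '' K) (n : ℕ) {x : X} (hx : x ∈ K) :
    ∃ w : List ι, w.length = n ∧ x ∈ wordMap S w '' K := by
  induction n generalizing x with
  | zero => exact ⟨[], rfl, x, hx, rfl⟩
  | succ n ih =>
    rw [hK] at hx
    obtain ⟨i, y, hy, rfl⟩ := mem_iUnion.1 hx
    obtain ⟨w, hw, z, hz, rfl⟩ := ih hy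
    exact ⟨i :: w, by rw [List.length_cons, hw], z, hz, rfl⟩

theorem disjoint_image_wordMap {X ι : Type*} [MetricSpace X] {S : ι → X → X} {r : ι → ℝ}
    (hS : ∀ i x y, dist (S i x) (S i y) = r i * dist x y) (hr : ∀ i, 0 < r i)
    {K : Set X} (hK : K = ⋃ i, S i '' K) {a b : List ι}
    (hab : Disjoint (wordMap S a '' K) (wordMap S b '' K)) (c a' b' : List ι) :
    Disjoint (wordMap S (c ++ (a ++ a')) '' K) (wordMap S (c ++ (b ++ b')) '' K) := by
  rw [wordMap_append, wordMap_append S c, image_comp, image_comp]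
  exact (disjoint_image_iff (wordMap_injective hS hr c)).2
    (hab.mono (image_wordMap_append_subset hK a a') (image_wordMap_append_subset hK b b'))

/-- If the invariant set of a system of contracting similarities has two points, then it has two
disjoint cylinders. -/
theorem exists_disjoint_words {X ι : Type*} [MetricSpace X] [Finite ι] {S : ι → X → X}
    {r : ι → ℝ} (hS : ∀ i x y, dist (S i x) (S i y) = r i * dist x y) (hr0 : ∀ i, 0 < r i)
    (hr1 : ∀ i, r i < 1) {K : Set X} (hK : K = ⋃ i, S i '' K) (hKb : Bornology.IsBounded K)
    (hK2 : K.Nontrivial) :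
    ∃ p q : List ι, p ≠ [] ∧ q ≠ [] ∧ Disjoint (wordMap S p '' K) (wordMap S q '' K) := by
  obtain ⟨x, hx, y, hy, hxy⟩ := hK2
  obtain ⟨ρ, hρ0, hρ1, hρ⟩ := exists_uniform_ratio hr1
  have hpos : 0 < dist x y := dist_pos.2 hxy
  have hlim : Filter.Tendsto (fun n : ℕ => ρ ^ n * (2 * diam K)) Filter.atTop (nhds 0) := by
    simpa using (tendsto_pow_atTop_nhds_zero_of_lt_one hρ0 hρ1).mul_const (2 * diam K)
  -- Two cylinders of diameter at most `ρ ^ n * diam K` around `x` and `y` cannot meet; `1 ≤ n`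
  -- makes the words nonempty.
  obtain ⟨n, hn, hn1⟩ :=
    ((hlim.eventually_lt_const hpos).and (Filter.eventually_ge_atTop 1)).exists
  obtain ⟨p, hp, x', hx', rfl⟩ := exists_mem_image_wordMap hK n hx
  obtain ⟨q, hq, y', hy', rfl⟩ := exists_mem_image_wordMap hK n hy
  refine ⟨p, q, by rintro rfl; simp at hp; omega, by rintro rfl; simp at hq; omega, ?_⟩
  rw [disjoint_left]
  rintro _ ⟨z, hz, rfl⟩ ⟨z', hz', hzz⟩
  have h1 := dist_wordMap hS p x' z
  have h2 := dist_wordMap hS q z' y'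
  have h3 := dist_triangle (wordMap S p x') (wordMap S p z) (wordMap S q y')
  have h4 := wordRatio_le_pow hr0 hρ p
  have h5 := wordRatio_le_pow hr0 hρ q
  have h6 := mul_le_mul h4 (dist_le_diam_of_mem hKb hx' hz) dist_nonneg (by positivity)
  have h7 := mul_le_mul h5 (dist_le_diam_of_mem hKb hz' hy') dist_nonneg (by positivity)
  rw [hzz] at h2
  rw [hp] at h6
  rw [hq] at h7
  linarith

/-! ### Large disjoint families of cylinders -/

/-- Below the Hausdorff dimension `t` of the invariant set of a system of contracting
similarities, there are finite families of disjoint cylinders whose sums of `t`-th powers of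
ratios are arbitrarily large. -/
theorem exists_disjoint_words_le_sum_rpow {X ι : Type*} [MetricSpace X] [Finite ι]
    {S : ι → X → X} {r : ι → ℝ} (hS : ∀ i x y, dist (S i x) (S i y) = r i * dist x y)
    (hr0 : ∀ i, 0 < r i) (hr1 : ∀ i, r i < 1) {K : Set X} (hK : K = ⋃ i, S i '' K)
    (hKb : Bornology.IsBounded K) (hne : K.Nonempty) {t : ℝ≥0} (ht : (t : ℝ≥0∞) < dimH K)
    (M : ℝ) :
    ∃ V : Finset (List ι), (V : Set (List ι)).PairwiseDisjoint (fun w => wordMap S w '' K) ∧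
      M ≤ ∑ w ∈ V, wordRatio r w ^ (t : ℝ) := by
  by_contra! hcon
  obtain ⟨ρ, hρ0, hρ1, hρ⟩ := exists_uniform_ratio hr1
  obtain ⟨x₀, hx₀⟩ := hne
  have hw0 := wordRatio_pos hr0
  have hcover : ∀ n : ℕ, ∃ V : Finset (List ι), (∀ w ∈ V, w.length = n) ∧
      (V : Set (List ι)).PairwiseDisjoint (fun w => wordMap S w '' K) ∧
      K ⊆ ⋃ w : V, closedBall (wordMap S w x₀) (3 * diam K * wordRatio r w) := by
    intro n
    -- Each cylinder of length `n` meets a selected one of at least half its ratio, which gives the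
    -- radius factor `3 = 2 + 1`.
    obtain ⟨u, hu, hdisj, hcov⟩ := Vitali.exists_disjoint_subfamily_covering_enlargement
      (fun w : List ι => wordMap S w '' K) {w | w.length = n} (wordRatio r) 2 one_lt_two
      (fun w _ => (hw0 w).le) (ρ ^ n) (fun w hw => hw ▸ wordRatio_le_pow hr0 hρ w)
      (fun w _ => ⟨_, x₀, hx₀, rfl⟩)
    have hfin : u.Finite := (List.finite_length_eq ι n).subset hu
    refine ⟨hfin.toFinset, fun w hw => hu (hfin.mem_toFinset.1 hw), by simpa using hdisj, ?_⟩
    intro x hx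
    obtain ⟨a, ha, x', hx', rfl⟩ := exists_mem_image_wordMap hK n hx
    obtain ⟨b, hb, ⟨z, ⟨z', hz', rfl⟩, z'', hz'', hzz⟩, hle⟩ := hcov a ha
    refine mem_iUnion.2 ⟨⟨b, hfin.mem_toFinset.2 hb⟩, ?_⟩
    rw [mem_closedBall]
    have h1 := dist_wordMap hS a x' z'
    have h2 := dist_wordMap hS b z'' x₀
    have h3 := dist_triangle (wordMap S a x') (wordMap S a z') (wordMap S b x₀)
    have h4 := mul_le_mul hle (dist_le_diam_of_mem hKb hx' hz') dist_nonneg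
      (mul_nonneg zero_le_two (hw0 b).le)
    have h5 := mul_le_mul_of_nonneg_left (dist_le_diam_of_mem hKb hz'' hx₀) (hw0 b).le
    rw [hzz] at h2
    dsimp only
    linarith
  choose V hlen hdisj hcov using hcover
  have hdiam : ∀ (n : ℕ) (w : V n),
      ediam (closedBall (wordMap S w x₀) (3 * diam K * wordRatio r (w : List ι))) ≤
        ENNReal.ofReal (6 * diam K * wordRatio r (w : List ι)) := by
    intro n w
    refine ediam_le fun x hx y hy => ?_
    rw [edist_dist]
    apply ENNReal.ofReal_le_ofReal
    have := dist_triangle_right x y (wordMap S w x₀)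
    rw [mem_closedBall] at hx hy
    linarith
  borelize X
  have hlim : Filter.Tendsto (fun n : ℕ => ENNReal.ofReal (6 * diam K * ρ ^ n)) Filter.atTop
      (nhds 0) := by
    rw [← ENNReal.ofReal_zero]
    apply ENNReal.tendsto_ofReal
    simpa using (tendsto_pow_atTop_nhds_zero_of_lt_one hρ0 hρ1).const_mul (6 * diam K)
  have hD : 0 ≤ 6 * diam K := mul_nonneg (by norm_num) diam_nonneg
  -- The measure is infinite for `t < dimH K`, whereas a bound `M` on all disjoint sums would make
  -- these covering sums bounded.
  have hμ := MeasureTheory.Measure.hausdorffMeasure_le_liminf_sum (t : ℝ) K _ hlim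
    (fun n (w : V n) => closedBall (wordMap S w x₀) (3 * diam K * wordRatio r (w : List ι)))
    (Filter.Eventually.of_forall fun n w => (hdiam n w).trans (ENNReal.ofReal_le_ofReal
      (mul_le_mul_of_nonneg_left
        ((wordRatio_le_pow hr0 hρ (w : List ι)).trans_eq (by rw [hlen n w w.2])) hD)))
    (Filter.Eventually.of_forall hcov)
  rw [hausdorffMeasure_of_lt_dimH ht, top_le_iff] at hμ
  have hle : ∀ n, ∑ w : V n,
      ediam (closedBall (wordMap S w x₀) (3 * diam K * wordRatio r (w : List ι))) ^ (t : ℝ) ≤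
        ENNReal.ofReal ((6 * diam K) ^ (t : ℝ) * M) := by
    intro n
    calc _ ≤ ∑ w : V n,
          ENNReal.ofReal ((6 * diam K) ^ (t : ℝ) * wordRatio r (w : List ι) ^ (t : ℝ)) := by
          refine Finset.sum_le_sum fun w _ => ?_
          rw [← Real.mul_rpow hD (hw0 w).le,
            ← ENNReal.ofReal_rpow_of_nonneg (mul_nonneg hD (hw0 w).le) t.coe_nonneg]
          exact ENNReal.rpow_le_rpow (hdiam n w) t.coe_nonneg
      _ = ENNReal.ofReal ((6 * diam K) ^ (t : ℝ) * ∑ w ∈ V n, wordRatio r w ^ (t : ℝ)) := by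
          rw [← ENNReal.ofReal_sum_of_nonneg, ← Finset.mul_sum,
            Finset.sum_coe_sort (V n) fun w => wordRatio r w ^ (t : ℝ)]
          exact fun w _ => mul_nonneg (Real.rpow_nonneg hD _) (Real.rpow_nonneg (hw0 w).le _)
      _ ≤ _ := ENNReal.ofReal_le_ofReal
          (mul_le_mul_of_nonneg_left (hcon (V n) (hdisj n)).le (Real.rpow_nonneg hD _))
  have hfin := Filter.liminf_le_liminf (f := Filter.atTop) (Filter.Eventually.of_forall hle)
  rw [hμ, Filter.liminf_const, top_le_iff] at hfin
  exact ENNReal.ofReal_ne_top hfin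

/-! ### Orthogonal parts -/

/-- After division by `r` the map is an isometry, hence affine by strict convexity; its linear part
is onto because the dimension is finite. -/
theorem IsContractingSimilarity.exists_isOrthogonalPart {d : ℕ} {S : Eucl d → Eucl d}
    (hS : IsContractingSimilarity S) :
    ∃ (r : ℝ) (T : OrthGroup d) (v : Eucl d), 0 < r ∧ r < 1 ∧
      ∀ x, S x = r • (T : Eucl d →L[ℝ] Eucl d) x + v := by
  obtain ⟨r, hr0, hr1, hS⟩ := hS
  have hiso : Isometry fun x => r⁻¹ • S x := Isometry.of_dist_eq fun x y => by
    rw [dist_smul₀, hS, Real.norm_of_nonneg (inv_pos.2 hr0).le, inv_mul_cancel_left₀ hr0.ne']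
  let A := hiso.affineIsometryOfStrictConvexSpace
  let L := A.linearIsometry.toLinearIsometryEquiv rfl
  refine ⟨r, Unitary.linearIsometryEquiv.symm L, S 0, hr0, hr1, fun x => ?_⟩
  have h1 : L x = r⁻¹ • S x - r⁻¹ • S 0 := by
    have h : A.linearIsometry x = A x - A 0 := by simpa using A.map_vsub x 0
    exact h
  change S x = r • L x + S 0
  rw [h1, ← smul_sub, smul_inv_smul₀ hr0.ne', sub_add_cancel]

theorem norm_orthGroup_apply {d : ℕ} (T : OrthGroup d) (x : Eucl d) :
    ‖(T : Eucl d →L[ℝ] Eucl d) x‖ = ‖x‖ :=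
  (Unitary.linearIsometryEquiv T).norm_map x

/-- The value at 0 determines `v`, and the norm at a nonzero vector then determines `r`. -/
theorem IsOrthogonalPart.unique {d : ℕ} [Nontrivial (Eucl d)] {S : Eucl d → Eucl d}
    {T T' : OrthGroup d} (h : IsOrthogonalPart T S) (h' : IsOrthogonalPart T' S) : T = T' := by
  obtain ⟨r, v, hr0, -, h⟩ := h
  obtain ⟨r', v', hr0', -, h'⟩ := h'
  have hv : v = v' := by
    have h1 := h 0
    rw [h'] at h1
    simpa using h1.symm
  have heq : ∀ x, r • (T : Eucl d →L[ℝ] Eucl d) x = r' • (T' : Eucl d →L[ℝ] Eucl d) x := by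
    intro x
    have h1 := h x
    rw [h', ← hv] at h1
    exact (add_right_cancel h1).symm
  have hr : r = r' := by
    obtain ⟨x, hx⟩ := exists_ne (0 : Eucl d)
    have h1 := congrArg norm (heq x)
    rw [norm_smul, norm_smul, norm_orthGroup_apply, norm_orthGroup_apply,
      Real.norm_of_nonneg hr0.le, Real.norm_of_nonneg hr0'.le] at h1
    exact mul_right_cancel₀ (norm_ne_zero_iff.2 hx) h1
  ext1
  ext1 x
  have h1 := heq x
  rw [← hr] at h1
  exact smul_right_injective _ hr0.ne' h1

/-- The product of the orthogonal parts along a finite word. -/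
noncomputable def wordOrth {ι : Type*} {d : ℕ} (T : ι → OrthGroup d) (w : List ι) : OrthGroup d :=
  (w.map T).prod

theorem wordOrth_append {ι : Type*} {d : ℕ} (T : ι → OrthGroup d) (u w : List ι) :
    wordOrth T (u ++ w) = wordOrth T u * wordOrth T w := by
  simp [wordOrth]

theorem exists_wordMap_eq {ι : Type*} {d : ℕ} {S : ι → Eucl d → Eucl d} {r : ι → ℝ}
    {T : ι → OrthGroup d} {v : ι → Eucl d}
    (hS : ∀ i x, S i x = r i • (T i : Eucl d →L[ℝ] Eucl d) x + v i) (w : List ι) :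
    ∃ u : Eucl d, ∀ x,
      wordMap S w x = wordRatio r w • (wordOrth T w : Eucl d →L[ℝ] Eucl d) x + u := by
  induction w with
  | nil => exact ⟨0, fun x => by simp [wordMap, wordRatio, wordOrth]⟩
  | cons i w ih =>
    obtain ⟨u, hu⟩ := ih
    refine ⟨r i • (T i : Eucl d →L[ℝ] Eucl d) u + v i, fun x => ?_⟩
    have h : (wordOrth T (i :: w) : Eucl d →L[ℝ] Eucl d) x =
        (T i : Eucl d →L[ℝ] Eucl d) ((wordOrth T w : Eucl d →L[ℝ] Eucl d) x) := by
      rw [wordOrth, List.map_cons, List.prod_cons]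
      rfl
    rw [wordMap, Function.comp_apply, hu, hS, wordRatio_cons, h, map_add, map_smul, smul_add,
      mul_smul, add_assoc]

/-! ### The separated subsystem and its group -/

/-- The word `w` repeated `k` times. -/
def wordPow {ι : Type*} (w : List ι) : ℕ → List ι
  | 0 => []
  | k + 1 => w ++ wordPow w k

theorem wordPow_add {ι : Type*} (w : List ι) (j k : ℕ) :
    wordPow w (j + k) = wordPow w j ++ wordPow w k := by
  induction j with
  | zero => simp [wordPow]
  | succ j ih => rw [Nat.succ_add, wordPow, wordPow, ih, List.append_assoc]

/-- A sequence of words that contains the empty word twice and then all one-letter words. -/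
def letterWord (m : ℕ) : ℕ → List (Fin m)
  | 0 => []
  | 1 => []
  | k + 2 => if h : k < m then [⟨k, h⟩] else []

/-- The words `p ^ (k + 1) q u` with `u` empty or a letter, together with the words `q v`. -/
def separatedWord {m : ℕ} (p q : List (Fin m)) (V : Finset (List (Fin m))) :
    Fin (m + 2) ⊕ V → List (Fin m)
  | Sum.inl k => wordPow p k ++ (p ++ (q ++ letterWord m k))
  | Sum.inr v => q ++ v

/-- The two empty suffixes put `pq` and `p(pq)` in the group, hence `p` and then `q`; cancelling
these from the remaining words leaves each letter. -/
theorem closure_separatedWord {d m : ℕ} (T : Fin m → OrthGroup d) (p q : List (Fin m))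
    (V : Finset (List (Fin m))) :
    Subgroup.closure (range fun i => wordOrth T (separatedWord p q V i)) =
      Subgroup.closure (range T) := by
  apply le_antisymm
  · rw [Subgroup.closure_le]
    rintro _ ⟨i, rfl⟩
    refine Subgroup.list_prod_mem _ fun x hx => ?_
    obtain ⟨j, -, rfl⟩ := List.mem_map.1 hx
    exact Subgroup.subset_closure ⟨j, rfl⟩
  · rw [Subgroup.closure_le]
    rintro _ ⟨i, rfl⟩
    set H := Subgroup.closure (range fun i => wordOrth T (separatedWord p q V i)) with hH
    have hmem : ∀ k : Fin (m + 2), wordOrth T (wordPow p k) *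
        (wordOrth T p * (wordOrth T q * wordOrth T (letterWord m k))) ∈ H := fun k => by
      rw [← wordOrth_append, ← wordOrth_append, ← wordOrth_append]
      exact Subgroup.subset_closure ⟨Sum.inl k, rfl⟩
    have h0 : wordOrth T p * wordOrth T q ∈ H := by
      simpa [wordPow, letterWord, wordOrth] using hmem ⟨0, by omega⟩
    have h1 : wordOrth T p * (wordOrth T p * wordOrth T q) ∈ H := by
      simpa [wordPow, letterWord, wordOrth] using hmem ⟨1, by omega⟩
    have hp : wordOrth T p ∈ H := (H.mul_mem_cancel_right h0).1 h1
    have hq : wordOrth T q ∈ H := (H.mul_mem_cancel_left hp).1 h0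
    have hpow : ∀ k, wordOrth T (wordPow p k) ∈ H := fun k => by
      induction k with
      | zero => exact H.one_mem
      | succ k ih =>
        rw [wordPow, wordOrth_append]
        exact H.mul_mem hp ih
    have h2 := hmem ⟨i + 2, by omega⟩
    rw [H.mul_mem_cancel_left (hpow _), H.mul_mem_cancel_left hp,
      H.mul_mem_cancel_left hq] at h2
    simpa [letterWord, wordOrth] using h2

/-- After removal of a common prefix, either one word continues with `p` and the other with `q`, or
both are words of `V`. -/
theorem disjoint_separatedWord {X : Type*} [MetricSpace X] {m : ℕ} {S : Fin m → X → X}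
    {r : Fin m → ℝ} (hS : ∀ i x y, dist (S i x) (S i y) = r i * dist x y) (hr : ∀ i, 0 < r i)
    {K : Set X} (hK : K = ⋃ i, S i '' K) {p q : List (Fin m)}
    (hpq : Disjoint (wordMap S p '' K) (wordMap S q '' K)) {V : Finset (List (Fin m))}
    (hV : (V : Set (List (Fin m))).PairwiseDisjoint fun w => wordMap S w '' K)
    (i j : Fin (m + 2) ⊕ V) (hij : i ≠ j) :
    Disjoint (wordMap S (separatedWord p q V i) '' K)
      (wordMap S (separatedWord p q V j) '' K) := by
  have hlt : ∀ k l : Fin (m + 2), k < l →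
      Disjoint (wordMap S (separatedWord p q V (Sum.inl k)) '' K)
        (wordMap S (separatedWord p q V (Sum.inl l)) '' K) := by
    intro k l hkl
    obtain ⟨n, hn⟩ := Nat.exists_eq_add_of_lt (Fin.lt_def.1 hkl)
    have hk : separatedWord p q V (Sum.inl k) =
        (wordPow p k ++ p) ++ (q ++ letterWord m k) := by
      simp [separatedWord]
    have hl : separatedWord p q V (Sum.inl l) =
        (wordPow p k ++ p) ++ (p ++ (wordPow p n ++ (q ++ letterWord m l))) := by
      have h1 : ∀ n, wordPow p n ++ p = p ++ wordPow p n := fun n => by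
        have := wordPow_add p n 1
        simp only [wordPow, List.append_nil] at this
        exact this.symm
      simp only [separatedWord]
      rw [hn, add_assoc, wordPow_add, wordPow_add]
      simp only [wordPow, List.append_nil, List.append_assoc]
      rw [← List.append_assoc (wordPow p n) p, h1]
      simp only [List.append_assoc]
      rw [← List.append_assoc (wordPow p n) p, h1, List.append_assoc]
    rw [hk, hl]
    exact disjoint_image_wordMap hS hr hK hpq.symm _ _ _
  have hmix : ∀ (k : Fin (m + 2)) (v : V),
      Disjoint (wordMap S (separatedWord p q V (Sum.inl k)) '' K)
        (wordMap S (separatedWord p q V (Sum.inr v)) '' K) := by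
    intro k v
    refine Disjoint.mono ?_ (image_wordMap_append_subset hK q v) hpq
    simp only [separatedWord]
    cases hk : (k : ℕ) with
    | zero =>
      rw [wordPow, List.nil_append]
      exact image_wordMap_append_subset hK _ _
    | succ n =>
      rw [wordPow, List.append_assoc]
      exact image_wordMap_append_subset hK _ _
  rcases i with k | v <;> rcases j with l | w
  · rcases lt_or_gt_of_ne (fun h => hij (congrArg Sum.inl h)) with h | h
    · exact hlt k l h
    · exact (hlt l k h).symm
  · exact hmix k w
  · exact (hmix l v).symm
  · have h := hV v.2 w.2 fun h => hij (congrArg Sum.inr (Subtype.ext h))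
    simpa [separatedWord] using disjoint_image_wordMap hS hr hK h q [] []

theorem transformationGroup_eq {d m : ℕ} [Nontrivial (Eucl d)] {S : Fin m → Eucl d → Eucl d}
    {T : Fin m → OrthGroup d} (hT : ∀ i, IsOrthogonalPart (T i) (S i)) :
    transformationGroup S = Subgroup.closure (range T) := by
  have h : {U | ∃ i, IsOrthogonalPart U (S i)} = range T := by
    ext U
    constructor
    · rintro ⟨i, hi⟩
      exact ⟨i, (hT i).unique hi⟩
    · rintro ⟨i, rfl⟩
      exact ⟨i, hT i⟩
  rw [transformationGroup, h]

/-- Every finite family of disjoint cylinders gives a strongly separated system with the same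
transformation group, whose attractor has the dimension that the family provides. -/
theorem exists_separated_system {d m : ℕ} {S : Fin m → Eucl d → Eucl d} {K : Set (Eucl d)}
    {r : Fin m → ℝ} {T : Fin m → OrthGroup d} {v : Fin m → Eucl d}
    (hr0 : ∀ i, 0 < r i) (hr1 : ∀ i, r i < 1)
    (hS : ∀ i x, S i x = r i • (T i : Eucl d →L[ℝ] Eucl d) x + v i)
    (hd : ∀ i x y, dist (S i x) (S i y) = r i * dist x y)
    (hK : IsAttractor S K) (hK2 : K.Nontrivial) {p q : List (Fin m)} (hp : p ≠ [])
    (hq : q ≠ []) (hpq : Disjoint (wordMap S p '' K) (wordMap S q '' K))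
    {V : Finset (List (Fin m))}
    (hV : (V : Set (List (Fin m))).PairwiseDisjoint fun w => wordMap S w '' K) :
    ∃ (m' : ℕ) (S' : Fin m' → Eucl d → Eucl d) (K' : Set (Eucl d)),
      IsSSIFS S' ∧ IsAttractor S' K' ∧ K'.Nontrivial ∧ StrongSeparation S' K' ∧ K' ⊆ K ∧
      transformationGroup S' = transformationGroup S ∧
      ∀ t : ℝ≥0, 0 < t →
        1 ≤ wordRatio r q ^ (t : ℝ) * ∑ w ∈ V, wordRatio r w ^ (t : ℝ) →
        (t : ℝ≥0∞) ≤ dimH K' := by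
  have : Nontrivial (Eucl d) := by
    obtain ⟨x, -, y, -, h⟩ := hK2
    exact ⟨x, y, h⟩
  let e : Fin (m + 2) ⊕ V ≃ Fin (Fintype.card (Fin (m + 2) ⊕ V)) := Fintype.equivFin _
  let word : Fin (Fintype.card (Fin (m + 2) ⊕ V)) → List (Fin m) :=
    fun i => separatedWord p q V (e.symm i)
  have hword : ∀ i, word i ≠ [] := fun i => by
    simp only [word]
    cases e.symm i <;> simp [separatedWord, hp, hq]
  let S' := fun i => wordMap S (word i)
  let r' := fun i => wordRatio r (word i)
  have hd' : ∀ i x y, dist (S' i x) (S' i y) = r' i * dist x y :=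
    fun i => dist_wordMap hd (word i)
  have hr0' : ∀ i, 0 < r' i := fun i => wordRatio_pos hr0 _
  have hr1' : ∀ i, r' i < 1 := fun i => wordRatio_lt_one hr0 hr1 (hword i)
  have hdisj : ∀ i j, i ≠ j → Disjoint (S' i '' K) (S' j '' K) := fun i j hij =>
    disjoint_separatedWord hd hr0 hK.eq_iUnion hpq hV _ _ (e.symm.injective.ne hij)
  have : Nonempty (Fin (Fintype.card (Fin (m + 2) ⊕ V))) := ⟨e (Sum.inl 0)⟩
  obtain ⟨K', hK'K, hne, hcomp, heq⟩ := exists_isCompact_eq_iUnion_image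
    (c := fun i => (r' i).toNNReal) (fun i => Real.toNNReal_lt_one.2 (hr1' i))
    (fun i => LipschitzWith.of_dist_le' fun x y => (hd' i x y).le) hK.isCompact hK.nonempty
    (fun i => mapsTo_wordMap hK.eq_iUnion (word i))
  have hdisj' : ∀ i j, i ≠ j → Disjoint (S' i '' K') (S' j '' K') := fun i j hij =>
    (hdisj i j hij).mono (image_mono hK'K) (image_mono hK'K)
  have hmaps : ∀ i, MapsTo (S' i) K' K' := fun i x hx => by
    rw [heq]
    exact mem_iUnion.2 ⟨i, x, hx, rfl⟩
  refine ⟨_, S', K', fun i => ⟨r' i, hr0' i, hr1' i, hd' i⟩, ⟨hne, hcomp, heq⟩, ?_, hdisj',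
    hK'K, ?_, fun t ht hsum => ?_⟩
  · obtain ⟨x, hx⟩ := hne
    -- The words with `k = 0` and `k = 1` exist even for empty `V`, so disjoint images of one point
    -- already give two points.
    have h01 : e (Sum.inl 0) ≠ e (Sum.inl 1) := e.injective.ne (by simp)
    exact ⟨_, hmaps _ hx, _, hmaps _ hx,
      (hdisj' _ _ h01).ne_of_mem ⟨x, hx, rfl⟩ ⟨x, hx, rfl⟩⟩
  · rw [transformationGroup_eq (S := S) fun i => ⟨r i, v i, hr0 i, hr1 i, hS i⟩,
      transformationGroup_eq (S := S') (T := fun i => wordOrth T (word i)) fun i => by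
        obtain ⟨u, hu⟩ := exists_wordMap_eq hS (word i)
        exact ⟨r' i, u, hr0' i, hr1' i, hu⟩,
      ← closure_separatedWord T p q V]
    congr 1
    exact e.symm.surjective.range_comp fun i => wordOrth T (separatedWord p q V i)
  · refine le_dimH_of_one_le_sum_rpow hr0' hr1' hd' hcomp hne hmaps hdisj' ht (hsum.trans ?_)
    have h1 : ∑ i, r' i ^ (t : ℝ) =
        ∑ i, wordRatio r (separatedWord p q V i) ^ (t : ℝ) :=
      e.symm.sum_comp fun i => wordRatio r (separatedWord p q V i) ^ (t : ℝ)
    rw [h1, Fintype.sum_sum_type, Finset.mul_sum,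
      ← Finset.sum_coe_sort V fun w => wordRatio r q ^ (t : ℝ) * wordRatio r w ^ (t : ℝ)]
    refine le_add_of_nonneg_of_le
      (Finset.sum_nonneg fun i _ => Real.rpow_nonneg (wordRatio_pos hr0 _).le _)
      (Finset.sum_le_sum fun w _ => ?_)
    simp only [separatedWord]
    rw [wordRatio_append, Real.mul_rpow (wordRatio_pos hr0 _).le (wordRatio_pos hr0 _).le]

end SelfSimilar

/-! ### Choice of the exponent and conclusion -/

open SelfSimilar in
open scoped NNReal ENNReal in
theorem mainTheorem8 {d m : ℕ} (S : Fin m → SelfSimilar.Eucl d → SelfSimilar.Eucl d)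
    (K : Set (SelfSimilar.Eucl d)) (hS : SelfSimilar.IsSSIFS S)
    (hK : SelfSimilar.IsAttractor S K) (hK2 : K.Nontrivial) (ε : ℝ) (hε : 0 < ε) :
    ∃ (m' : ℕ) (S' : Fin m' → SelfSimilar.Eucl d → SelfSimilar.Eucl d)
      (K' : Set (SelfSimilar.Eucl d)),
      SelfSimilar.IsSSIFS S' ∧ SelfSimilar.IsAttractor S' K' ∧ K'.Nontrivial ∧
      SelfSimilar.StrongSeparation S' K' ∧ K' ⊆ K ∧
      dimH K < dimH K' + ENNReal.ofReal ε ∧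
      SelfSimilar.transformationGroup S' ≤ SelfSimilar.transformationGroup S ∧
      (SelfSimilar.transformationGroup S : Set (SelfSimilar.OrthGroup d)) ⊆
        closure (SelfSimilar.transformationGroup S' : Set (SelfSimilar.OrthGroup d)) := by
  choose r T v hr0 hr1 hSr using fun i => (hS i).exists_isOrthogonalPart
  have hd : ∀ i x y, dist (S i x) (S i y) = r i * dist x y := fun i x y => by
    rw [hSr, hSr, dist_add_right, dist_smul₀, Real.norm_of_nonneg (hr0 i).le, dist_eq_norm,
      ← map_sub, norm_orthGroup_apply, ← dist_eq_norm]
  obtain ⟨p, q, hp, hq, hpq⟩ := exists_disjoint_words hd hr0 hr1 hK.eq_iUnion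
    hK.isCompact.isBounded hK2
  have hfin : dimH K ≠ ⊤ := by
    refine ((dimH_mono (Set.subset_univ K)).trans_lt ?_).ne
    rw [Real.dimH_univ_eq_finrank]
    exact ENNReal.natCast_lt_top _
  obtain ⟨D, hD⟩ : ∃ D : ℝ≥0, (D : ℝ≥0∞) = dimH K := ⟨_, ENNReal.coe_toNNReal hfin⟩
  have hε' : 0 < ε.toNNReal := Real.toNNReal_pos.2 hε
  -- If `dimH K < ε`, any separated system works, so `V` is empty. Otherwise `t = D - ε / 2` is
  -- positive and below `D`, and the sum over `V` is taken at least `(r_q ^ t)⁻¹` to compensate for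
  -- the prefix `q`.
  rcases lt_or_ge D ε.toNNReal with hlt | hge
  · obtain ⟨m', S', K', h1, h2, h3, h4, h5, h6, -⟩ := exists_separated_system hr0 hr1 hSr hd hK
      hK2 hp hq hpq (V := ∅) (by simp)
    refine ⟨m', S', K', h1, h2, h3, h4, h5, ?_, h6.le, h6 ▸ subset_closure⟩
    rw [← hD]
    exact lt_of_lt_of_le (ENNReal.coe_lt_coe.2 hlt) le_add_self
  · have ht0 : 0 < D - ε.toNNReal / 2 :=
      tsub_pos_of_lt ((NNReal.half_lt_self hε'.ne').trans_le hge)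
    have htD : D - ε.toNNReal / 2 < D := tsub_lt_self (hε'.trans_le hge) (half_pos hε')
    set t := D - ε.toNNReal / 2 with ht
    obtain ⟨V, hV, hM⟩ := exists_disjoint_words_le_sum_rpow hd hr0 hr1 hK.eq_iUnion
      hK.isCompact.isBounded hK.nonempty (t := t) (hD ▸ ENNReal.coe_lt_coe.2 htD)
      (wordRatio r q ^ (t : ℝ))⁻¹
    obtain ⟨m', S', K', h1, h2, h3, h4, h5, h6, h7⟩ := exists_separated_system hr0 hr1 hSr hd hK
      hK2 hp hq hpq hV
    refine ⟨m', S', K', h1, h2, h3, h4, h5, ?_, h6.le, h6 ▸ subset_closure⟩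
    have hq0 : 0 < wordRatio r q ^ (t : ℝ) := Real.rpow_pos_of_pos (wordRatio_pos hr0 q) _
    have hle := h7 t ht0 ((inv_le_iff_one_le_mul₀' hq0).1 hM)
    refine lt_of_lt_of_le ?_ (add_le_add_left hle _)
    rw [← hD, ENNReal.ofReal, ← ENNReal.coe_add, ENNReal.coe_lt_coe]
    have h8 : D ≤ t + ε.toNNReal / 2 := le_tsub_add
    exact h8.trans_lt (add_lt_add_right (NNReal.half_lt_self hε'.ne') _)
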